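/- Let $k\ge 1$ be a fixed integer. An instance of $k$-CRCS ($k$-Coloring Reconfiguration under Color Swapping) consists of a finite simple graph $G$ and two proper $k$-colorings $f_s,f_t\colon V(G)\to\{1,\dots,k\}$. Two proper $k$-colorings $f,f'$ of $G$ are adjacent if there is exactly one edge $uv\in E(G)$ with $f(u)=f'(v)$ and $f(v)=f'(u)$, and $f(w)=f'(w)$ for all $w\in V(G)\setminus\{u,v\}$. They are reconfigurable if there is a finite sequence of proper $k$-colorings of $G$ starting with $f$ and ending with $f'$ in which consecutive colorings are adjacent. A graph is split if its vertex set can be partitioned into a clique and an independent set. Then $k$-CRCS on split graphs is solvable in polynomial time: there are a deterministic Turing machine and a polynomial $p$ such that on every instance $(G,f_s,f_t)$ of $k$-CRCS, written as a word of length $N$ (the colors of the vertices under $f_s$ and $f_t$ together with the adjacency matrix of $G$), the machine halts after at most $p(N)$ steps and decides whether $G$ is a split graph and $f_s$ and $f_t$ are reconfigurable. In particular, on split graphs it decides whether $f_s$ and $f_t$ are reconfigurable. -/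

import Mathlib

namespace ColorSwap

/-- Two proper `k`-colorings `f`, `f'` of `G` are adjacent under color swapping: there is exactly
one edge `uv` with `f u = f' v` and `f v = f' u`, and `f`, `f'` agree on all vertices other than
`u` and `v`. -/
def SwapAdj {V : Type} {G : SimpleGraph V} {k : ℕ} (f f' : G.Coloring (Fin k)) : Prop :=
  ∃ u v : V, G.Adj u v ∧ f u = f' v ∧ f v = f' u ∧
    (∀ x y : V, G.Adj x y → f x = f' y → f y = f' x → s(x, y) = s(u, v)) ∧
    ∀ w : V, w ≠ u → w ≠ v → f w = f' w

/-- There is a finite sequence of proper `k`-colorings from `f` to `f'`, consecutive ones being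
adjacent under color swapping. -/
def Reconfigurable {V : Type} {G : SimpleGraph V} {k : ℕ} (f f' : G.Coloring (Fin k)) : Prop :=
  Relation.ReflTransGen SwapAdj f f'

/-- The vertex set is the union of a clique and an independent set. -/
def IsSplit {V : Type} (G : SimpleGraph V) : Prop :=
  ∃ C I : Set V, C ∪ I = Set.univ ∧ Disjoint C I ∧ G.IsClique C ∧ G.IsIndepSet I

/-- An instance of `k`-CRCS: a finite graph with two proper `k`-colorings. -/
structure Instance (k : ℕ) where
  n : ℕ
  graph : SimpleGraph (Fin n)
  fs : graph.Coloring (Fin k)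
  ft : graph.Coloring (Fin k)

/-- The finite input alphabet: adjacency bits, and pairs of colors. -/
abbrev Symbol (k : ℕ) : Type := Bool ⊕ (Fin k × Fin k)

open scoped Classical in
/-- The block of a vertex `v`: its initial and target color, then row `v` of the adjacency
matrix. -/
noncomputable def Instance.block {k : ℕ} (I : Instance k) (v : Fin I.n) : List (Symbol k) :=
  Sum.inr (I.fs v, I.ft v) ::
    (List.finRange I.n).map fun w => Sum.inl (decide (I.graph.Adj v w))

/-- An instance with `n` vertices is written as the `n` blocks of its vertices, so as a word of
length `n * (n + 1)`. -/
noncomputable def Instance.encode {k : ℕ} (I : Instance k) : List (Symbol k) :=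
  (List.finRange I.n).flatMap I.block

/-- The decision problem `P` on inputs of type `α`, written as words by `enc`, is decided by a
deterministic (multi-stack) Turing machine that halts within a number of steps polynomial in the
length of the input word. -/
def SolvableInPolyTime {α Γ : Type} (enc : α → List Γ) (P : α → Prop) : Prop :=
  ∃ f : α → Bool, (∀ a, f a = true ↔ P a) ∧
    Nonempty (Turing.TM2ComputableInPolyTime enc Computability.encodeBool f)

end ColorSwap

namespace ColorSwap

/-! Call vertices twins if they have the same neighborhood, initial color and target color. Twins
are not adjacent, and neither is ever recolored: swapping one of them with a neighbor would give
that neighbor the color of the other. Hence, if every vertex outside an induced subgraph (the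
kernel) has at least two twins in it, then swap sequences restrict to the kernel and lift from it,
and the graph is split exactly when the kernel is.

In a split graph the clique has at most one vertex of each color, so the number of twin classes is
bounded in terms of `k`. Selecting vertices greedily, at most two from each twin class, therefore
gives a kernel of bounded size. A machine with finitely many stacks makes this selection while
reading the adjacency matrix row by row, in linear time: each column carries its adjacencies to the
vertices selected so far, which is what is needed to recognize twins. If the selection grows beyond
the bound, the graph is not split; otherwise the kernel is one of finitely many instances, whose
answers the machine holds in its control. -/

/-! ### Kernels -/

section Kernel

variable {V W : Type} {G : SimpleGraph V} {H : SimpleGraph W} {k : ℕ}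

theorem SwapAdj.of_swap {f f' : G.Coloring (Fin k)} {u v : V} (huv : G.Adj u v)
    (hu : f u = f' v) (hv : f v = f' u) (hrest : ∀ w, w ≠ u → w ≠ v → f w = f' w) :
    SwapAdj f f' := by
  refine ⟨u, v, huv, hu, hv, fun x y hxy hx hy => ?_, hrest⟩
  have := f.valid hxy
  have := f'.valid hxy
  have := f.valid huv
  by_cases hxu : x = u <;> by_cases hxv : x = v <;> by_cases hyu : y = u <;>
    by_cases hyv : y = v <;> simp_all

theorem SwapAdj.eq_of_twins {f f' : G.Coloring (Fin k)} (h : SwapAdj f f') {x y : V}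
    (hxy : x ≠ y) (hN : G.neighborSet x = G.neighborSet y) (hc : f x = f y) : f' x = f x := by
  obtain ⟨u, v, huv, hu, hv, -, hrest⟩ := h
  -- A swap along `xw` would give `w` the color of `y`, which is adjacent to `w`.
  have ne_endpoint : ∀ u w, G.Adj u w → f u = f' w →
      (∀ z, z ≠ u → z ≠ w → f z = f' z) → x ≠ u := by
    rintro _ w hxw hcw hrest rfl
    have hyw : w ∈ G.neighborSet y := hN ▸ hxw
    exact f'.valid hyw (by rw [← hrest y hxy.symm hyw.ne, ← hc, hcw])
  exact (hrest x (ne_endpoint u v huv hu hrest)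
    (ne_endpoint v u huv.symm hv fun z hzv hzu => hrest z hzu hzv)).symm

theorem Reconfigurable.eq_of_twins {f f' : G.Coloring (Fin k)} (h : Reconfigurable f f')
    {x y : V} (hxy : x ≠ y) (hN : G.neighborSet x = G.neighborSet y) (hc : f x = f y) :
    f' x = f x := by
  suffices f' x = f x ∧ f' y = f y from this.1
  induction h with
  | refl => exact ⟨rfl, rfl⟩
  | @tail f₁ f₂ _ hstep ih =>
    have hc₁ : f₁ x = f₁ y := ih.1.trans (hc.trans ih.2.symm)
    exact ⟨(hstep.eq_of_twins hxy hN hc₁).trans ih.1,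
      (hstep.eq_of_twins hxy.symm hN.symm hc₁.symm).trans ih.2⟩

/-- The initial color, the target color and the neighborhood of a vertex. Vertices with equal
profiles are called twins. -/
def profile (fs ft : G.Coloring (Fin k)) (v : V) : (Fin k × Fin k) × Set V :=
  ((fs v, ft v), G.neighborSet v)

/-- The induced subgraph `φ` is a kernel: every vertex it omits has at least two twins in it. -/
def RetainsTwins (φ : H ↪g G) (fs ft : G.Coloring (Fin k)) : Prop :=
  ∀ v ∉ Set.range φ, ∃ a b, a ≠ b ∧
    profile fs ft (φ a) = profile fs ft v ∧ profile fs ft (φ b) = profile fs ft v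

section Profile

variable {φ : H ↪g G} {fs ft : G.Coloring (Fin k)}

theorem initial_eq_of_profile_eq {u v : V} (h : profile fs ft u = profile fs ft v) :
    fs u = fs v :=
  congrArg (·.1.1) h

theorem target_eq_of_profile_eq {u v : V} (h : profile fs ft u = profile fs ft v) :
    ft u = ft v :=
  congrArg (·.1.2) h

theorem neighborSet_eq_of_profile_eq {u v : V} (h : profile fs ft u = profile fs ft v) :
    G.neighborSet u = G.neighborSet v :=
  congrArg Prod.snd h

theorem not_adj_of_profile_eq {u v : V} (h : profile fs ft u = profile fs ft v) :
    ¬G.Adj u v := fun huv =>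
  G.loopless.irrefl v (show v ∈ G.neighborSet v from neighborSet_eq_of_profile_eq h ▸ huv)

theorem neighborSet_eq_of_profile_embedding_eq {a b : W}
    (h : profile fs ft (φ a) = profile fs ft (φ b)) : H.neighborSet a = H.neighborSet b := by
  ext c
  have hc : φ c ∈ G.neighborSet (φ a) ↔ φ c ∈ G.neighborSet (φ b) := by
    rw [neighborSet_eq_of_profile_eq h]
  simpa only [SimpleGraph.mem_neighborSet, φ.map_adj_iff] using hc

theorem adj_retract_iff {r : V → W} (hr : ∀ v, profile fs ft (φ (r v)) = profile fs ft v)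
    (v w : V) : H.Adj (r v) (r w) ↔ G.Adj v w := by
  have adj_iff (u x : V) : G.Adj (φ (r u)) x ↔ G.Adj u x :=
    Set.ext_iff.1 (neighborSet_eq_of_profile_eq (hr u)) x
  rw [← φ.map_adj_iff, adj_iff, G.adj_comm, adj_iff, G.adj_comm]

end Profile

namespace RetainsTwins

variable {φ : H ↪g G} {fs ft : G.Coloring (Fin k)}

/-- Two twins are not adjacent, so one of those retained for an omitted vertex avoids the
clique. -/
theorem exists_retract (hφ : RetainsTwins φ fs ft) {C : Set W} (hC : H.IsClique C) :
    ∃ r : V → W, (∀ a, r (φ a) = a) ∧ (∀ v, profile fs ft (φ (r v)) = profile fs ft v) ∧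
      ∀ v ∉ Set.range φ, r v ∉ C := by
  have exists_image (v : V) : ∃ a, profile fs ft (φ a) = profile fs ft v ∧
      (v ∈ Set.range φ → φ a = v) ∧ (v ∉ Set.range φ → a ∉ C) := by
    by_cases hv : v ∈ Set.range φ
    · obtain ⟨a, rfl⟩ := hv
      exact ⟨a, rfl, fun _ => rfl, fun h => absurd ⟨a, rfl⟩ h⟩
    · obtain ⟨a, b, hab, ha, hb⟩ := hφ v hv
      by_cases haC : a ∈ C
      · have hbC : b ∉ C := fun hbC =>
          not_adj_of_profile_eq (ha.trans hb.symm) (φ.map_adj_iff.2 (hC haC hbC hab))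
        exact ⟨b, hb, fun h => absurd h hv, fun _ => hbC⟩
      · exact ⟨a, ha, fun h => absurd h hv, fun _ => haC⟩
  choose r hprofile hrange havoid using exists_image
  exact ⟨r, fun a => φ.injective (hrange _ ⟨a, rfl⟩), hprofile, havoid⟩

theorem isSplit_iff (hφ : RetainsTwins φ fs ft) : IsSplit G ↔ IsSplit H := by
  constructor
  · rintro ⟨C, I, hu, hd, hC, hI⟩
    refine ⟨φ ⁻¹' C, φ ⁻¹' I, by rw [← Set.preimage_union, hu, Set.preimage_univ],
      hd.preimage φ, fun x hx y hy hxy => ?_, fun x hx y hy hxy => ?_⟩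
    · exact φ.map_adj_iff.1 (hC hx hy (φ.injective.ne hxy))
    · exact fun h => hI hx hy (φ.injective.ne hxy) (φ.map_adj_iff.2 h)
  · rintro ⟨C, I, hu, -, hC, hI⟩
    obtain ⟨r, hrφ, hr, hrC⟩ := hφ.exists_retract hC
    have retract_mem (v : V) (hv : v ∉ φ '' C) : r v ∈ I := by
      refine (hu ▸ Set.mem_univ (r v) : r v ∈ C ∪ I).resolve_left fun hvC => ?_
      by_cases hrange : v ∈ Set.range φ
      · obtain ⟨a, rfl⟩ := hrange
        exact hv ⟨a, hrφ a ▸ hvC, rfl⟩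
      · exact hrC v hrange hvC
    refine ⟨φ '' C, (φ '' C)ᶜ, Set.union_compl_self _, disjoint_compl_right, ?_, ?_⟩
    · rintro _ ⟨x, hx, rfl⟩ _ ⟨y, hy, rfl⟩ hxy
      exact φ.map_adj_iff.2 (hC hx hy (ne_of_apply_ne φ hxy))
    · intro x hx y hy _ hadj
      have hadj' := (adj_retract_iff hr x y).2 hadj
      exact hI (retract_mem x hx) (retract_mem y hy) hadj'.ne hadj'

theorem eq_initial_of_reconfigurable (hφ : RetainsTwins φ fs ft) {f : G.Coloring (Fin k)}
    (h : Reconfigurable fs f) {v : V} (hv : v ∉ Set.range φ) : f v = fs v := by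
  obtain ⟨a, _, _, ha, _⟩ := hφ v hv
  exact h.eq_of_twins (fun hva => hv ⟨a, hva.symm⟩) (neighborSet_eq_of_profile_eq ha).symm
    (initial_eq_of_profile_eq ha).symm

theorem reconfigurable_comp (hφ : RetainsTwins φ fs ft) {f : G.Coloring (Fin k)}
    (h : Reconfigurable fs f) : Reconfigurable (fs.comp φ.toHom) (f.comp φ.toHom) := by
  induction h with
  | refl => exact .refl
  | @tail f₁ f₂ hpath hstep ih =>
    refine ih.tail ?_
    have frozen (v : V) (hv : v ∉ Set.range φ) : f₁ v = f₂ v :=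
      (hφ.eq_initial_of_reconfigurable hpath hv).trans
        (hφ.eq_initial_of_reconfigurable (hpath.tail hstep) hv).symm
    obtain ⟨u, v, huv, hu, hv, -, hrest⟩ := hstep
    obtain ⟨a, rfl⟩ : u ∈ Set.range φ := by
      by_contra hur
      exact f₁.valid huv ((frozen u hur).trans hv.symm)
    obtain ⟨b, rfl⟩ : v ∈ Set.range φ := by
      by_contra hvr
      exact f₁.valid huv (hu.trans (frozen v hvr).symm)
    exact .of_swap (φ.map_adj_iff.1 huv) hu hv fun w hwa hwb =>
      hrest (φ w) (φ.injective.ne hwa) (φ.injective.ne hwb)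

theorem eq_initial_of_reconfigurable_comp (hφ : RetainsTwins φ fs ft)
    {g : H.Coloring (Fin k)} (h : Reconfigurable (fs.comp φ.toHom) g) {v : V}
    (hv : v ∉ Set.range φ) {a : W} (ha : profile fs ft (φ a) = profile fs ft v) :
    g a = fs (φ a) := by
  obtain ⟨b, hab, hb⟩ : ∃ b, a ≠ b ∧ profile fs ft (φ b) = profile fs ft v := by
    obtain ⟨b, c, hbc, hb, hc⟩ := hφ v hv
    by_cases hab : a = b
    · exact ⟨c, hab ▸ hbc, hc⟩
    · exact ⟨b, hab, hb⟩
  have htwins := ha.trans hb.symm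
  exact h.eq_of_twins hab (neighborSet_eq_of_profile_embedding_eq htwins)
    (show fs (φ a) = fs (φ b) from initial_eq_of_profile_eq htwins)

/-- A coloring of the kernel extends to `G` by giving an omitted vertex the color of a twin. A swap
in the kernel recolors no such twin, so it lifts to a swap in `G`. -/
theorem reconfigurable_of_comp (hφ : RetainsTwins φ fs ft)
    (h : Reconfigurable (fs.comp φ.toHom) (ft.comp φ.toHom)) : Reconfigurable fs ft := by
  obtain ⟨r, hrφ, hr, -⟩ := hφ.exists_retract (H.isClique_empty)
  let ρ : G →g H := ⟨r, fun {v w} => (adj_retract_iff hr v w).2⟩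
  have comp_initial : (fs.comp φ.toHom).comp ρ = fs :=
    RelHom.ext fun v => initial_eq_of_profile_eq (hr v)
  have comp_target : (ft.comp φ.toHom).comp ρ = ft :=
    RelHom.ext fun v => target_eq_of_profile_eq (hr v)
  suffices ∀ g, Reconfigurable (fs.comp φ.toHom) g → Reconfigurable fs (g.comp ρ) from
    comp_target ▸ this _ h
  intro g hg
  induction hg with
  | refl => rw [comp_initial]; exact .refl
  | @tail g₁ g₂ hpath hstep ih =>
    refine ih.tail ?_
    have frozen (w : V) (hw : w ∉ Set.range φ) : g₁ (r w) = g₂ (r w) :=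
      (hφ.eq_initial_of_reconfigurable_comp hpath hw (hr w)).trans
        (hφ.eq_initial_of_reconfigurable_comp (hpath.tail hstep) hw (hr w)).symm
    obtain ⟨a, b, hab, ha, hb, -, hrest⟩ := hstep
    have comp_apply (g : H.Coloring (Fin k)) (c : W) : g.comp ρ (φ c) = g c := congrArg g (hrφ c)
    refine .of_swap (φ.map_adj_iff.2 hab) (by simpa only [comp_apply] using ha)
      (by simpa only [comp_apply] using hb) fun w hwa hwb => ?_
    by_cases hw : w ∈ Set.range φ
    · obtain ⟨c, rfl⟩ := hw
      simpa only [comp_apply] using hrest c (ne_of_apply_ne φ hwa) (ne_of_apply_ne φ hwb)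
    · exact frozen w hw

theorem reconfigurable_iff (hφ : RetainsTwins φ fs ft) :
    Reconfigurable fs ft ↔ Reconfigurable (fs.comp φ.toHom) (ft.comp φ.toHom) :=
  ⟨hφ.reconfigurable_comp, hφ.reconfigurable_of_comp⟩

end RetainsTwins

/-- The clique contains at most one vertex of each color, and a vertex outside the clique has all
its neighbors in it. So a profile is known from the colors of the vertex, whether it belongs to
the clique, and the colors of its neighbors in the clique. -/
theorem IsSplit.exists_profile_factorsThrough (hG : IsSplit G) (fs ft : G.Coloring (Fin k)) :
    ∃ key : V → (Fin k × Fin k) × Prop × Set (Fin k),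
      (profile fs ft).FactorsThrough key := by
  obtain ⟨C, I, hu, -, hC, hI⟩ := hG
  have injOn_clique : Set.InjOn fs C := fun x hx y hy hxy => by
    by_contra hne
    exact fs.valid (hC hx hy hne) hxy
  have mem_clique_of_adj {u w : V} (huC : u ∉ C) (huw : G.Adj u w) : w ∈ C := by
    by_contra hwC
    have mem_indep {x : V} (hx : x ∉ C) : x ∈ I :=
      (hu ▸ Set.mem_univ x : x ∈ C ∪ I).resolve_left hx
    exact hI (mem_indep huC) (mem_indep hwC) huw.ne huw
  have neighborSet_subset {u v : V} (huC : u ∉ C)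
      (h : fs '' (G.neighborSet u ∩ C) = fs '' (G.neighborSet v ∩ C)) :
      G.neighborSet u ⊆ G.neighborSet v := fun w huw => by
    have hwC := mem_clique_of_adj huC huw
    obtain ⟨w', ⟨hvw', hw'C⟩, hw'⟩ : fs w ∈ fs '' (G.neighborSet v ∩ C) :=
      h ▸ ⟨w, ⟨huw, hwC⟩, rfl⟩
    exact injOn_clique hw'C hwC hw' ▸ hvw'
  refine ⟨fun v => ((fs v, ft v), v ∈ C, fs '' (G.neighborSet v ∩ C)), fun u v huv => ?_⟩
  obtain ⟨hcolors, hmem, hN⟩ := by simpa only [Prod.mk.injEq] using huv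
  by_cases huC : u ∈ C
  · rw [injOn_clique huC (hmem ▸ huC) hcolors.1]
  · exact Prod.ext (Prod.ext hcolors.1 hcolors.2)
      ((neighborSet_subset huC hN).antisymm (neighborSet_subset (hmem ▸ huC) hN.symm))

end Kernel

/-! ### Greedy selection -/

section Thinning

open scoped List

variable {V β : Type} [DecidableEq β] (p : V → β) (N : ℕ)

/-- Append `v` to `us`, unless `us` has reached the length `N` or already contains two entries with
the same value of `p` as `v`. -/
def thinStep (us : List V) (v : V) : List V :=
  if us.length < N ∧ ¬(us.map p).Duplicate (p v) then us ++ [v] else us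

/-- The greedy selection from a list of at most `N` entries, at most two for each value of `p`. -/
def thin (vs : List V) : List V :=
  vs.foldl (thinStep p N) []

theorem thin_concat (vs : List V) (v : V) :
    thin p N (vs ++ [v]) = thinStep p N (thin p N vs) v := by
  simp only [thin, List.foldl_append, List.foldl_cons, List.foldl_nil]

theorem prefix_thinStep (us : List V) (v : V) : us <+: thinStep p N us v := by
  unfold thinStep
  split_ifs
  exacts [List.prefix_append us [v], List.prefix_rfl]

theorem thin_sublist (vs : List V) : thin p N vs <+ vs := by
  induction vs using List.reverseRecOn with
  | nil => exact List.Sublist.refl []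
  | append_singleton vs v ih =>
    rw [thin_concat, thinStep]
    split_ifs
    exacts [ih.append_right [v], ih.trans (List.sublist_append_left vs [v])]

theorem length_thin_le (vs : List V) : (thin p N vs).length ≤ N := by
  induction vs using List.reverseRecOn with
  | nil => exact Nat.zero_le N
  | append_singleton vs v ih =>
    rw [thin_concat, thinStep]
    split_ifs with h
    · rw [List.length_append, List.length_singleton]
      exact h.1
    · exact ih

theorem count_map_thin_le_two (vs : List V) (b : β) : ((thin p N vs).map p).count b ≤ 2 := by
  induction vs using List.reverseRecOn with
  | nil => exact Nat.zero_le 2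
  | append_singleton vs v ih =>
    rw [thin_concat, thinStep]
    split_ifs with h
    · rw [List.duplicate_iff_two_le_count, not_le] at h
      rw [List.map_append, List.count_append, List.map_singleton, List.count_singleton]
      split_ifs with hb
      · obtain rfl : p v = b := by simpa only [beq_iff_eq] using hb
        lia
      · exact ih
    · exact ih

theorem duplicate_map_thin {vs : List V} (hlen : (thin p N vs).length < N) {v : V}
    (hv : v ∈ vs) (hthin : v ∉ thin p N vs) : ((thin p N vs).map p).Duplicate (p v) := by
  induction vs using List.reverseRecOn with
  | nil => exact absurd hv List.not_mem_nil
  | append_singleton vs w ih =>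
    rw [thin_concat] at hlen hthin ⊢
    have extended := prefix_thinStep p N (thin p N vs) w
    have hlen' := extended.length_le.trans_lt hlen
    rcases List.mem_append.1 hv with hv | hv
    · exact (ih hlen' hv fun h => hthin (extended.subset h)).mono_sublist
        (extended.sublist.map p)
    · obtain rfl := List.mem_singleton.1 hv
      by_contra hdup
      have hfresh : ¬((thin p N vs).map p).Duplicate (p v) := fun h =>
        hdup (h.mono_sublist (extended.sublist.map p))
      rw [thinStep, if_pos ⟨hlen', hfresh⟩] at hthin
      exact hthin (List.mem_append_right _ hv)

theorem length_thin_le_two_mul_card {A : Type} [Finite A] {key : V → A}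
    (hkey : p.FactorsThrough key) (vs : List V) : (thin p N vs).length ≤ 2 * Nat.card A := by
  classical
  have := Fintype.ofFinite A
  set us := thin p N vs
  have count_key (a : A) (ha : a ∈ (us.map key).toFinset) : (us.map key).count a ≤ 2 := by
    obtain ⟨u, -, rfl⟩ := List.mem_map.1 (List.mem_toFinset.1 ha)
    calc (us.map key).count (key u) ≤ (us.map p).count (p u) := by
          simp only [List.count, List.countP_map]
          exact List.countP_mono_left fun v _ hv => by
            simpa only [Function.comp_apply, beq_iff_eq] using
              hkey (by simpa only [Function.comp_apply, beq_iff_eq] using hv)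
      _ ≤ 2 := count_map_thin_le_two p N vs (p u)
  calc us.length = ∑ a ∈ (us.map key).toFinset, (us.map key).count a := by
        rw [List.sum_toFinset_count_eq_length, List.length_map]
    _ ≤ (us.map key).toFinset.card * 2 := Finset.sum_le_card_nsmul _ _ _ count_key
    _ ≤ 2 * Nat.card A := by
        rw [mul_comm, Nat.card_eq_fintype_card]
        exact Nat.mul_le_mul_left 2 (Finset.card_le_univ _)

end Thinning

/-! ### Stack automata -/

section StackAutomata

open Turing StateTransition

/-- What a stack automaton does to one stack in one step. -/
inductive StackAction (A : Type) where
  | keep : StackAction A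
  | pop : StackAction A
  | push : A → StackAction A

namespace StackAction

variable {A : Type}

/-- The effect of an action on the contents of a stack. -/
def apply : StackAction A → List A → List A
  | keep, S => S
  | pop, S => S.tail
  | push a, S => a :: S

/-- Whether an action is `pop`. -/
def isPop : StackAction A → Bool
  | pop => true
  | _ => false

/-- The symbol pushed by an action, if any. -/
def pushed : StackAction A → Option A
  | push a => some a
  | _ => none

end StackAction

/-- A deterministic automaton with stacks indexed by `K`. In one step it reads the control state
and the tops of all stacks, acts on every stack, and either changes the state or (`none`) halts. -/
structure StackAutomaton (K : Type) (Γ : K → Type) (Q : Type) where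
  init : Q
  trans : Q → (∀ s, Option (Γ s)) → Option Q × ∀ s, StackAction (Γ s)

namespace StackAutomaton

variable {K : Type} {Γ : K → Type} {Q : Type}

/-- A configuration: the control state, which is `none` after halting, and the stacks. -/
abbrev Cfg (Γ : K → Type) (Q : Type) : Type := Option Q × ∀ s, List (Γ s)

/-- One step of the automaton, undefined on halted configurations. -/
def step (A : StackAutomaton K Γ Q) : Cfg Γ Q → Option (Cfg Γ Q)
  | (none, _) => none
  | (some q, S) =>
    let next := A.trans q fun s => (S s).head?
    some (next.1, fun s => (next.2 s).apply (S s))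

/-- The automaton gets from `c` to `c'` in at most `t` steps. -/
def ReachesIn (A : StackAutomaton K Γ Q) (t : ℕ) (c c' : Cfg Γ Q) : Prop :=
  Nonempty (EvalsToInTime A.step c (some c') t)

namespace ReachesIn

variable {A : StackAutomaton K Γ Q} {c d e : Cfg Γ Q} {s t : ℕ}

theorem refl (A : StackAutomaton K Γ Q) (c : Cfg Γ Q) : A.ReachesIn 0 c c :=
  ⟨.refl A.step c⟩

theorem of_trans {q : Q} {S : ∀ s, List (Γ s)}
    (hq : (A.trans q fun s => (S s).head?).1 = d.1)
    (hS : ∀ s, ((A.trans q fun s => (S s).head?).2 s).apply (S s) = d.2 s) :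
    A.ReachesIn 1 (some q, S) d :=
  ⟨⟨⟨1, congrArg some (Prod.ext hq (funext hS))⟩, le_rfl⟩⟩

theorem trans (hcd : A.ReachesIn s c d) (hde : A.ReachesIn t d e) : A.ReachesIn (s + t) c e :=
  let ⟨E⟩ := hcd
  let ⟨F⟩ := hde
  add_comm s t ▸ ⟨.trans A.step s t c d (some e) E F⟩

theorem mono (h : A.ReachesIn s c d) (hst : s ≤ t) : A.ReachesIn t c d :=
  let ⟨E⟩ := h
  ⟨⟨E.toEvalsTo, E.steps_le_m.trans hst⟩⟩

end ReachesIn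

section Simulation

variable [DecidableEq K]

/-- The variables of the simulating machine: the control state and the stack tops it has read. -/
abbrev Store (Γ : K → Type) (Q : Type) : Type := Q × ∀ s, Option (Γ s)

/-- Read the tops of the listed stacks, then run `p`. -/
def peekAll (p : TM2.Stmt Γ Unit (Store Γ Q)) : List K → TM2.Stmt Γ Unit (Store Γ Q)
  | [] => p
  | s :: l => .peek s (fun v top => (v.1, Function.update v.2 s top)) (peekAll p l)

theorem stepAux_peekAll (p : TM2.Stmt Γ Unit (Store Γ Q)) (l : List K) (q : Q)
    (tops : ∀ s, Option (Γ s)) (S : ∀ s, List (Γ s)) :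
    TM2.stepAux (peekAll p l) (q, tops) S =
      TM2.stepAux p (q, fun s => if s ∈ l then (S s).head? else tops s) S := by
  induction l generalizing tops with
  | nil => simp only [peekAll, List.not_mem_nil, if_false]
  | cons a l ih =>
    rw [peekAll, TM2.stepAux, ih]
    congr 2
    funext s
    obtain rfl | hs := eq_or_ne s a
    · simp
    · simp [hs]

theorem dite_eq_update (i : K) (l : List (Γ i)) :
    (fun s => if h : s = i then (by rw [h]; exact l) else ([] : List (Γ s))) =
      Function.update (fun _ => []) i l := by
  funext s
  obtain rfl | hs := eq_or_ne s i
  · simp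
  · simp [hs]

variable [∀ s, Inhabited (Γ s)]

/-- Act on the listed stacks as prescribed by the transition function, then run `p`. -/
def actAll (A : StackAutomaton K Γ Q) (p : TM2.Stmt Γ Unit (Store Γ Q)) :
    List K → TM2.Stmt Γ Unit (Store Γ Q)
  | [] => p
  | s :: l =>
    let action (v : Store Γ Q) := (A.trans v.1 v.2).2 s
    .branch (fun v => (action v).isPop) (.pop s (fun v _ => v) (actAll A p l)) <|
      .branch (fun v => (action v).pushed.isSome)
        (.push s (fun v => (action v).pushed.getD default) (actAll A p l))
        (actAll A p l)

theorem stepAux_actAll (A : StackAutomaton K Γ Q) (p : TM2.Stmt Γ Unit (Store Γ Q)) (l : List K)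
    (hl : l.Nodup) (v : Store Γ Q) (S : ∀ s, List (Γ s)) :
    TM2.stepAux (actAll A p l) v S =
      TM2.stepAux p v fun s => if s ∈ l then ((A.trans v.1 v.2).2 s).apply (S s) else S s := by
  induction l generalizing S with
  | nil => simp only [actAll, List.not_mem_nil, if_false]
  | cons a l ih =>
    have act_head : TM2.stepAux (actAll A p (a :: l)) v S = TM2.stepAux (actAll A p l) v
        (Function.update S a (((A.trans v.1 v.2).2 a).apply (S a))) := by
      rw [actAll]
      cases h : (A.trans v.1 v.2).2 a <;>
        simp [h, StackAction.isPop, StackAction.pushed, StackAction.apply]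
    rw [act_head, ih hl.of_cons]
    congr 1
    funext s
    obtain rfl | hs := eq_or_ne s a
    · simp [(List.nodup_cons.1 hl).1]
    · simp [hs]

variable [Fintype K]

/-- The program simulating one step of a stack automaton. It leaves behind the initial contents
of the store before halting, and no stack tops otherwise. -/
noncomputable def program (A : StackAutomaton K Γ Q) : TM2.Stmt Γ Unit (Store Γ Q) :=
  let next (v : Store Γ Q) := (A.trans v.1 v.2).1
  let continuation : TM2.Stmt Γ Unit (Store Γ Q) :=
    .branch (fun v => (next v).isSome)
      (.load (fun v => ((next v).getD A.init, fun _ => none)) (.goto fun _ => ()))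
      (.load (fun _ => (A.init, fun _ => none)) .halt)
  peekAll (actAll A continuation Finset.univ.toList) Finset.univ.toList

/-- The Turing machine simulating a stack automaton with input stack `i` and output stack `o`. -/
noncomputable def machine (A : StackAutomaton K Γ Q) [Fintype Q] [∀ s, Fintype (Γ s)] (i o : K) :
    FinTM2 where
  K := K
  k₀ := i
  k₁ := o
  Γ := Γ
  Λ := Unit
  main := ()
  σ := Store Γ Q
  initialState := (A.init, fun _ => none)
  m _ := A.program

/-- The configuration of the simulating machine between two simulated steps. -/
def machineCfg (A : StackAutomaton K Γ Q) : Cfg Γ Q → TM2.Cfg Γ Unit (Store Γ Q)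
  | (some q, S) => ⟨some (), (q, fun _ => none), S⟩
  | (none, S) => ⟨none, (A.init, fun _ => none), S⟩

theorem step_machineCfg (A : StackAutomaton K Γ Q) (c : Cfg Γ Q) :
    TM2.step (fun _ : Unit => A.program) (A.machineCfg c) = (A.step c).map A.machineCfg := by
  obtain ⟨_ | q, S⟩ := c
  · rfl
  · cases h : (A.trans q fun s => (S s).head?).1 <;>
      simp [machineCfg, step, program, stepAux_peekAll, stepAux_actAll, Finset.nodup_toList, h]

theorem initList_machine (A : StackAutomaton K Γ Q) [Fintype Q] [∀ s, Fintype (Γ s)] (i o : K)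
    (l : List (Γ i)) : initList (A.machine i o) l =
      A.machineCfg (some A.init, Function.update (fun _ => []) i l) :=
  congrArg (TM2.Cfg.mk _ _) (dite_eq_update i l)

theorem haltList_machine (A : StackAutomaton K Γ Q) [Fintype Q] [∀ s, Fintype (Γ s)] (i o : K)
    (l : List (Γ o)) : haltList (A.machine i o) l =
      A.machineCfg (none, Function.update (fun _ => []) o l) :=
  congrArg (TM2.Cfg.mk _ _) (dite_eq_update o l)

end Simulation
end StackAutomaton

theorem nonempty_evalsToInTime_map {σ τ : Type*} {f : σ → Option σ} {g : τ → Option τ} {φ : σ → τ}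
    (hφ : ∀ a, g (φ a) = (f a).map φ) {a b : σ} {t : ℕ}
    (h : Nonempty (EvalsToInTime f a (some b) t)) :
    Nonempty (EvalsToInTime g (φ a) (some (φ b)) t) := by
  obtain ⟨⟨n, hn⟩, hnt⟩ := h
  have semiconj : Function.Semiconj (Option.map φ) (flip bind f) (flip bind g) := by
    rintro (_ | x)
    exacts [rfl, (hφ x).symm]
  refine ⟨⟨⟨n, ?_⟩, hnt⟩⟩
  have := (semiconj.iterate_right n) (some a)
  rw [hn] at this
  exact this.symm

namespace StackAutomaton

variable {K : Type} [Finite K] [DecidableEq K] {Γ : K → Type} [∀ s, Finite (Γ s)]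
  [∀ s, Inhabited (Γ s)] {Q : Type} [Finite Q]

theorem nonempty_tm2ComputableInPolyTime {α : Type} (A : StackAutomaton K Γ Q) (i o : K)
    (eo : Γ o ≃ Bool) (enc : α → List (Γ i)) (f : α → Bool) (p : Polynomial ℕ)
    (h : ∀ a, A.ReachesIn (p.eval (enc a).length)
      (some A.init, Function.update (fun _ => []) i (enc a))
      (none, Function.update (fun _ => []) o [eo.symm (f a)])) :
    Nonempty (TM2ComputableInPolyTime enc Computability.encodeBool f) := by
  have := Fintype.ofFinite K
  have := Fintype.ofFinite Q
  have (s : K) := Fintype.ofFinite (Γ s)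
  refine ⟨⟨⟨A.machine i o, Equiv.refl _, eo⟩, p, fun a => Nonempty.some ?_⟩⟩
  have input_eq : (enc a).map (Equiv.refl (Γ i)).invFun = enc a := List.map_id _
  have run := nonempty_evalsToInTime_map A.step_machineCfg (h a)
  rw [← A.initList_machine i o, ← A.haltList_machine i o, ← input_eq, List.length_map] at run
  exact run

end StackAutomaton

end StackAutomata

/-! ### Scanning a matrix -/

/-- A square matrix of entries in `B` whose rows have headers in `H`. -/
structure HeadedMatrix (H B : Type) where
  n : ℕ
  header : Fin n → H
  entry : Fin n → Fin n → B

namespace HeadedMatrix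

variable {H B : Type} (M : HeadedMatrix H B)

/-- The word for row `v`: its header, then its entries. -/
def row (v : Fin M.n) : List (B ⊕ H) :=
  .inr (M.header v) :: (List.finRange M.n).map fun w => .inl (M.entry v w)

/-- The matrix as a word, row by row. -/
def encode : List (B ⊕ H) :=
  (List.finRange M.n).flatMap M.row

theorem length_encode : M.encode.length = M.n * (M.n + 1) := by
  simp [encode, row, List.length_flatMap]

end HeadedMatrix

/-- A decision procedure that passes once over a headed matrix, row by row. It maintains a memory
in `σ` and, for each column, a cell in `C`. Along a row it gathers evidence in `ε` from the cells
and the entries (`read`) and overwrites the cells (`write`); at the end of the row it decides from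
the evidence whether to `mark` the row, in which case it extends its memory by the header. In the
end it collects the cells of the columns whose row is marked into `τ` and answers. -/
structure MatrixScanner (H B C σ ε τ : Type) where
  blank : C
  init : σ
  start : ε
  read : ε → C → B → ε
  write : σ → C → B → C
  mark : σ → H → ε → Bool
  extend : σ → H → σ
  empty : τ
  collect : C → τ → τ
  answer : σ → τ → Bool

namespace MatrixScanner

/-- The stacks of the automaton implementing a scanner. The cells of the columns still to be
visited in the current row are in `todo`, and those already visited are in `done`. -/
inductive Stack where
  | input
  | output
  | todo
  | done
  | marks
  deriving DecidableEq

instance : Fintype Stack where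
  elems := {.input, .output, .todo, .done, .marks}
  complete s := by cases s <;> decide

variable {H B C σ ε τ : Type} (S : MatrixScanner H B C σ ε τ) (M : HeadedMatrix H B)

/-- The state of a scan between two rows. The scanned rows are listed latest first, each with the
decision made on it. -/
structure State (C σ : Type) (n : ℕ) where
  memory : σ
  cell : Fin n → C
  decisions : List (Fin n × Bool)

/-- The marked rows in the order of the scan. -/
def State.marked {n : ℕ} (s : State C σ n) : List (Fin n) :=
  ((s.decisions.filter (·.2)).map (·.1)).reverse

/-- The evidence gathered along row `v` from the columns in `ws`, starting from `e`. -/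
def evidence (cell : Fin M.n → C) (v : Fin M.n) (e : ε) (ws : List (Fin M.n)) : ε :=
  ws.foldl (fun e w => S.read e (cell w) (M.entry v w)) e

/-- Whether row `v` is marked when it is scanned in the state `s`. -/
def marksRow (s : State C σ M.n) (v : Fin M.n) : Bool :=
  S.mark s.memory (M.header v) (S.evidence M s.cell v S.start (List.finRange M.n))

/-- The effect of scanning row `v`. -/
def scanRow (s : State C σ M.n) (v : Fin M.n) : State C σ M.n where
  memory := if S.marksRow M s v then S.extend s.memory (M.header v) else s.memory
  cell w := S.write s.memory (s.cell w) (M.entry v w)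
  decisions := (v, S.marksRow M s v) :: s.decisions

/-- The state before the first row. -/
def initialState : State C σ M.n :=
  ⟨S.init, fun _ => S.blank, []⟩

/-- The state after scanning the rows in `vs`. -/
def scan (vs : List (Fin M.n)) : State C σ M.n :=
  vs.foldl (S.scanRow M) (S.initialState M)

theorem marked_scanRow (s : State C σ M.n) (v : Fin M.n) :
    (S.scanRow M s v).marked = if S.marksRow M s v then s.marked ++ [v] else s.marked := by
  unfold State.marked scanRow
  split_ifs with h <;> simp [h]

theorem scan_concat (vs : List (Fin M.n)) (v : Fin M.n) :
    S.scan M (vs ++ [v]) = S.scanRow M (S.scan M vs) v :=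
  List.foldl_concat ..

/-- The answer given after scanning all rows. -/
def outcome : Bool :=
  let s := S.scan M (List.finRange M.n)
  S.answer s.memory ((s.marked.map s.cell).foldr S.collect S.empty)

/-- The alphabets of the stacks. -/
abbrev Alphabet (H B C : Type) : Stack → Type
  | .input => B ⊕ H
  | .output => Bool
  | .todo => C
  | .done => C
  | .marks => Bool

/-- The control states of the automaton: moving the cells back to `todo` before a row, moving along
a row, and collecting the cells of the marked rows. -/
inductive Control (H σ ε τ : Type) where
  | rewind (m : σ)
  | scan (m : σ) (h : H) (e : ε)
  | collect (m : σ) (t : τ)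

/-- A family indexed by the stacks, given by its members. -/
def onStacks {F : Type → Type} (input : F (B ⊕ H)) (output : F Bool) (todo done : F C)
    (marks : F Bool) : ∀ s, F (Alphabet H B C s)
  | .input => input
  | .output => output
  | .todo => todo
  | .done => done
  | .marks => marks

/-- The automaton implementing a scanner. At the end of a row it returns to `rewind`; an empty
stack `todo` stands for cells that are all blank. -/
def automaton : StackAutomaton Stack (Alphabet H B C) (Control H σ ε τ) where
  init := .rewind S.init
  trans
    | .rewind m, top => match top .input, top .done with
      | none, _ => (some (.collect m S.empty), onStacks .keep .keep .keep .keep .keep)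
      | some _, some x => (some (.rewind m), onStacks .keep .keep (.push x) .pop .keep)
      | some (.inr h), none =>
        (some (.scan m h S.start), onStacks .pop .keep .keep .keep .keep)
      | some (.inl _), none => (none, onStacks .keep .keep .keep .keep .keep)
    | .scan m h e, top => match top .input with
      | some (.inl b) =>
        let x := (top .todo).getD S.blank
        (some (.scan m h (S.read e x b)), onStacks .pop .keep .pop (.push (S.write m x b)) .keep)
      | _ =>
        let marked := S.mark m h e
        (some (.rewind (if marked then S.extend m h else m)),
          onStacks .keep .keep .keep .keep (.push marked))
    | .collect m t, top => match top .marks with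
      | some marked =>
        let x := (top .done).getD S.blank
        (some (.collect m (if marked then S.collect x t else t)),
          onStacks .keep .keep .keep .pop .pop)
      | none => (none, onStacks .keep (.push (S.answer m t)) .keep .keep .keep)

/-- The stack `t` holds the cells `xs`, where an empty stack stands for any number of blanks. -/
def Represents (t xs : List C) : Prop :=
  t = xs ∨ t = [] ∧ ∀ x ∈ xs, x = S.blank

namespace Represents

variable {S} {t xs : List C}

theorem eq_nil (h : S.Represents t []) : t = [] :=
  h.elim id And.left

theorem reverse (h : S.Represents t xs) : S.Represents t.reverse xs.reverse :=
  h.imp (congrArg List.reverse) fun ⟨ht, hxs⟩ =>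
    ⟨congrArg List.reverse ht, fun x hx => hxs x (List.mem_reverse.1 hx)⟩

theorem head_getD {x : C} (h : S.Represents t (x :: xs)) : t.head?.getD S.blank = x := by
  obtain rfl | ⟨rfl, hxs⟩ := h
  exacts [rfl, (hxs x List.mem_cons_self).symm]

theorem tail {x : C} (h : S.Represents t (x :: xs)) : S.Represents t.tail xs := by
  obtain rfl | ⟨rfl, hxs⟩ := h
  exacts [.inl rfl, .inr ⟨rfl, fun y hy => hxs y (List.mem_cons_of_mem x hy)⟩]

end Represents

section Run

variable {S M}

theorem reachesIn_rewind (m : σ) (a : B ⊕ H) (input : List (B ⊕ H)) (todo done : List C)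
    (marks : List Bool) :
    S.automaton.ReachesIn done.length
      (some (.rewind m), onStacks (a :: input) [] todo done marks)
      (some (.rewind m), onStacks (a :: input) [] (done.reverse ++ todo) [] marks) := by
  induction done generalizing todo with
  | nil => exact .refl _ _
  | cons x done ih =>
    rw [List.reverse_cons, List.append_assoc, List.singleton_append, List.length_cons, add_comm]
    exact .trans (.of_trans rfl fun s => by cases s <;> rfl) (ih (x :: todo))

theorem reachesIn_scan (m : σ) (h : H) (e : ε) (cell : Fin M.n → C) (v : Fin M.n)
    (ws : List (Fin M.n)) (input : List (B ⊕ H)) {todo : List C}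
    (htodo : S.Represents todo (ws.map cell)) (done : List C) (marks : List Bool) :
    S.automaton.ReachesIn ws.length
      (some (.scan m h e),
        onStacks (ws.map (fun w => .inl (M.entry v w)) ++ input) [] todo done marks)
      (some (.scan m h (S.evidence M cell v e ws)),
        onStacks input [] []
          ((ws.map fun w => S.write m (cell w) (M.entry v w)).reverse ++ done) marks) := by
  induction ws generalizing e todo done with
  | nil =>
    obtain rfl := htodo.eq_nil
    exact .refl _ _
  | cons w ws ih =>
    rw [List.map_cons (f := fun w => S.write _ _ _), List.reverse_cons, List.append_assoc,
      List.singleton_append, List.length_cons, add_comm]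
    have hhead := htodo.head_getD
    refine .trans (.of_trans (d := (some (.scan m h (S.read e (cell w) (M.entry v w))),
      onStacks (ws.map (fun w => .inl (M.entry v w)) ++ input) [] todo.tail
        (S.write m (cell w) (M.entry v w) :: done) marks)) ?_ fun s => ?_)
      (ih _ htodo.tail _)
    · rw [← hhead]; rfl
    · rw [← hhead]; cases s <;> rfl

theorem reachesIn_row_end (m : σ) (h : H) (e : ε) {input : List (B ⊕ H)}
    (hinput : ∀ b, input.head? ≠ some (.inl b)) (done : List C) (marks : List Bool) :
    S.automaton.ReachesIn 1 (some (.scan m h e), onStacks input [] [] done marks)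
      (some (.rewind (if S.mark m h e then S.extend m h else m)),
        onStacks input [] [] done (S.mark m h e :: marks)) := by
  rcases input with _ | ⟨b | h', input⟩
  · exact .of_trans rfl fun s => by cases s <;> rfl
  · exact absurd rfl (hinput b)
  · exact .of_trans rfl fun s => by cases s <;> rfl

theorem reachesIn_row (s : State C σ M.n) (v : Fin M.n) {input : List (B ⊕ H)}
    (hinput : ∀ b, input.head? ≠ some (.inl b)) {done : List C}
    (hdone : S.Represents done ((List.finRange M.n).map s.cell).reverse) :
    S.automaton.ReachesIn (2 * M.n + 2)
      (some (.rewind s.memory),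
        onStacks (M.row v ++ input) [] [] done (s.decisions.map (·.2)))
      (some (.rewind (S.scanRow M s v).memory),
        onStacks input [] [] ((List.finRange M.n).map (S.scanRow M s v).cell).reverse
          ((S.scanRow M s v).decisions.map (·.2))) := by
  have length_done_le : done.length ≤ M.n := by
    obtain rfl | ⟨rfl, -⟩ := hdone <;> simp
  have rewound := reachesIn_rewind (S := S) s.memory (.inr (M.header v))
    ((List.finRange M.n).map (fun w => .inl (M.entry v w)) ++ input) [] done
    (s.decisions.map (·.2))
  have htodo : S.Represents (done.reverse ++ []) ((List.finRange M.n).map s.cell) := by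
    simpa only [List.append_nil, List.reverse_reverse] using hdone.reverse
  have scanned := reachesIn_scan s.memory (M.header v) S.start s.cell v (List.finRange M.n) input
    htodo [] (s.decisions.map (·.2))
  have started := StackAutomaton.ReachesIn.of_trans (A := S.automaton)
    (q := .rewind s.memory) (S := onStacks (M.row v ++ input) [] (done.reverse ++ []) []
      (s.decisions.map (·.2))) (d := (some (.scan s.memory (M.header v) S.start), onStacks
        ((List.finRange M.n).map (fun w => .inl (M.entry v w)) ++ input) [] (done.reverse ++ []) []
        (s.decisions.map (·.2)))) rfl fun s => by cases s <;> rfl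
  have ended := reachesIn_row_end (S := S) s.memory (M.header v)
    (S.evidence M s.cell v S.start (List.finRange M.n)) hinput
    (((List.finRange M.n).map (S.scanRow M s v).cell).reverse ++ []) (s.decisions.map (·.2))
  have total := ((rewound.trans started).trans scanned).trans ended
  rw [List.append_nil, List.length_finRange] at total
  exact total.mono (by lia)

theorem reachesIn_rows (vs : List (Fin M.n)) (s : State C σ M.n) {done : List C}
    (hdone : S.Represents done ((List.finRange M.n).map s.cell).reverse) :
    let s' := vs.foldl (S.scanRow M) s
    ∃ done', S.Represents done' ((List.finRange M.n).map s'.cell).reverse ∧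
      S.automaton.ReachesIn (vs.length * (2 * M.n + 2))
        (some (.rewind s.memory), onStacks (vs.flatMap M.row) [] [] done (s.decisions.map (·.2)))
        (some (.rewind s'.memory), onStacks [] [] [] done' (s'.decisions.map (·.2))) := by
  induction vs generalizing s done with
  | nil => exact ⟨done, hdone, .mono (.refl _ _) (Nat.zero_le _)⟩
  | cons v vs ih =>
    obtain ⟨done', hdone', reached⟩ := ih (S.scanRow M s v) (.inl rfl)
    have head_ne (b : B) : (vs.flatMap M.row).head? ≠ some (.inl b) := by
      cases vs <;> simp [HeadedMatrix.row]
    refine ⟨done', hdone', ((reachesIn_row s v head_ne hdone).trans reached).mono ?_⟩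
    rw [List.length_cons]
    lia

theorem reachesIn_collect {α : Type} (cell : α → C) (m : σ) (t : τ) (ds : List (α × Bool))
    {done : List C} (hdone : S.Represents done (ds.map fun d => cell d.1)) :
    S.automaton.ReachesIn (ds.length + 1)
      (some (.collect m t), onStacks [] [] [] done (ds.map (·.2)))
      (none, onStacks [] [S.answer m
        ((ds.filter (·.2)).foldl (fun t d => S.collect (cell d.1) t) t)] [] [] []) := by
  induction ds generalizing t done with
  | nil =>
    obtain rfl := hdone.eq_nil
    exact .of_trans rfl fun s => by cases s <;> rfl
  | cons d ds ih =>
    obtain ⟨v, marked⟩ := d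
    have hhead : done.head?.getD S.blank = cell v := hdone.head_getD
    have step : S.automaton.ReachesIn 1
        (some (.collect m t), onStacks [] [] [] done (marked :: ds.map (·.2)))
        (some (.collect m (if marked then S.collect (cell v) t else t)),
          onStacks [] [] [] done.tail (ds.map (·.2))) := by
      refine .of_trans ?_ fun s => by cases s <;> rfl
      rw [← hhead]; rfl
    rw [List.length_cons, add_comm]
    refine .trans step ?_
    cases marked <;> exact ih _ hdone.tail

theorem map_fst_decisions_foldl (vs : List (Fin M.n)) (s : State C σ M.n) :
    (vs.foldl (S.scanRow M) s).decisions.map (·.1) = vs.reverse ++ s.decisions.map (·.1) := by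
  induction vs generalizing s with
  | nil => rfl
  | cons v vs ih =>
    rw [List.foldl_cons, ih, List.reverse_cons, List.append_assoc]
    rfl

variable (S M)

theorem reachesIn_outcome :
    S.automaton.ReachesIn (3 * M.encode.length + 2)
      (some S.automaton.init, onStacks M.encode [] [] [] [])
      (none, onStacks [] [S.outcome M] [] [] []) := by
  let s := S.scan M (List.finRange M.n)
  have blank_cells : S.Represents [] ((List.finRange M.n).map (S.initialState M).cell).reverse :=
    .inr ⟨rfl, by simp [initialState]⟩
  obtain ⟨done, hdone, scanned⟩ := reachesIn_rows (List.finRange M.n) _ blank_cells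
  have rows : s.decisions.map (·.1) = (List.finRange M.n).reverse := by
    simp [s, scan, map_fst_decisions_foldl, initialState]
  have length_decisions : s.decisions.length = M.n := by
    simpa using congrArg List.length rows
  have hdone : S.Represents done (s.decisions.map fun d => s.cell d.1) := by
    rwa [← List.map_reverse, ← rows, List.map_map] at hdone
  have started : S.automaton.ReachesIn 1
      (some (.rewind s.memory), onStacks [] [] [] done (s.decisions.map (·.2)))
      (some (.collect s.memory S.empty), onStacks [] [] [] done (s.decisions.map (·.2))) :=
    .of_trans rfl fun s => by cases s <;> rfl
  have collected := reachesIn_collect s.cell s.memory S.empty s.decisions hdone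
  have answer_eq : S.outcome M = S.answer s.memory
      ((s.decisions.filter (·.2)).foldl (fun t d => S.collect (s.cell d.1) t) S.empty) := by
    simp only [outcome, State.marked, List.map_reverse, List.foldr_reverse, List.foldl_map, s]
  rw [answer_eq]
  refine ((scanned.trans started).trans collected).mono ?_
  rw [length_decisions, List.length_finRange, M.length_encode]
  lia

end Run

instance [Finite H] [Finite σ] [Finite ε] [Finite τ] : Finite (Control H σ ε τ) := by
  let code : Control H σ ε τ → σ ⊕ (σ × H × ε) ⊕ (σ × τ)
    | .rewind m => .inl m
    | .scan m h e => .inr (.inl (m, h, e))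
    | .collect m t => .inr (.inr (m, t))
  refine .of_injective code fun p q h => ?_
  cases p <;> cases q <;> simp_all [code]

theorem solvableInPolyTime [Finite H] [Finite B] [Nonempty B] [Finite C] [Finite σ] [Finite ε]
    [Finite τ] {α : Type} (mat : α → HeadedMatrix H B) {P : α → Prop}
    (hP : ∀ a, S.outcome (mat a) = true ↔ P a) :
    SolvableInPolyTime (fun a => (mat a).encode) P := by
  refine ⟨fun a => S.outcome (mat a), hP, ?_⟩
  have (s : Stack) : Finite (Alphabet H B C s) := by cases s <;> infer_instance
  have (s : Stack) : Inhabited (Alphabet H B C s) :=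
    onStacks ⟨.inl (Classical.arbitrary B)⟩ ⟨false⟩ ⟨S.blank⟩ ⟨S.blank⟩ ⟨false⟩ s
  have input_eq (l : List (B ⊕ H)) : (Function.update (fun _ => []) .input l :
      ∀ s, List (Alphabet H B C s)) = onStacks l [] [] [] [] := by
    funext s
    cases s <;> rfl
  have output_eq (b : Bool) : (Function.update (fun _ => []) .output [b] :
      ∀ s, List (Alphabet H B C s)) = onStacks [] [b] [] [] [] := by
    funext s
    cases s <;> rfl
  refine S.automaton.nonempty_tm2ComputableInPolyTime .input .output (.refl Bool) _ _
    (3 * .X + 2) fun a => ?_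
  rw [input_eq]
  simpa [output_eq] using S.reachesIn_outcome (mat a)

end MatrixScanner

/-! ### Reading off the kernel -/

section Scanner

/-- The lists over `A` of length at most `N`. -/
abbrev BoundedList (A : Type) (N : ℕ) : Type := {l : List A // l.length ≤ N}

instance {A : Type} [Finite A] {N : ℕ} : Finite (BoundedList A N) :=
  List.finite_length_le A N

/-- The list `l` truncated to the length `N`. -/
def BoundedList.ofList {A : Type} (N : ℕ) (l : List A) : BoundedList A N :=
  ⟨l.take N, List.length_take_le N l⟩

theorem BoundedList.foldr_ofList_cons {A : Type} (N : ℕ) (l : List A) :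
    l.foldr (fun x t => ofList N (x :: t.1)) (ofList N []) = ofList N l := by
  induction l with
  | nil => rfl
  | cons x l ih =>
    rw [List.foldr_cons, ih]
    cases N <;> simp [ofList, List.take_take]

theorem duplicate_iff_nontrivial {A : Type} {l : List A} {N : ℕ} (hN : l.length ≤ N) (a : A) :
    l.Duplicate a ↔ {j : Fin N | l[(j : ℕ)]? = some a}.Nontrivial := by
  rw [List.duplicate_iff_exists_distinct_get]
  constructor
  · rintro ⟨i, j, hij, hi, hj⟩
    refine ⟨i.castLE hN, ?_, j.castLE hN, ?_, fun h => hij.ne (Fin.castLE_injective hN h)⟩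
    · simpa using hi.symm
    · simpa using hj.symm
  · rw [Set.nontrivial_iff_exists_lt]
    rintro ⟨i, hi, j, hj, hij⟩
    obtain ⟨hil, hi⟩ := List.getElem?_eq_some_iff.1 hi
    obtain ⟨hjl, hj⟩ := List.getElem?_eq_some_iff.1 hj
    exact ⟨⟨i, hil⟩, ⟨j, hjl⟩, hij, hi.symm, hj.symm⟩

variable {k N : ℕ}

namespace Instance

/-- An instance has a positive answer if its graph is split and its colorings are
reconfigurable. -/
def Positive (I : Instance k) : Prop :=
  IsSplit I.graph ∧ Reconfigurable I.fs I.ft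

/-- The initial and the target color of a vertex. -/
def colors (I : Instance k) (v : Fin I.n) : Fin k × Fin k :=
  (I.fs v, I.ft v)

open scoped Classical in
/-- The matrix with the entries of the adjacency matrix whose row headers are the colors of the
vertices. -/
noncomputable abbrev toMatrix (I : Instance k) : HeadedMatrix (Fin k × Fin k) Bool :=
  ⟨I.n, I.colors, fun v w => decide (I.graph.Adj v w)⟩

/-- The instance induced on the vertices in a list. -/
def restrict (I : Instance k) (us : List (Fin I.n)) : Instance k where
  n := us.length
  graph := I.graph.comap us.get
  fs := I.fs.comp (.comap us.get I.graph)
  ft := I.ft.comp (.comap us.get I.graph)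

/-- The instance `I` is described by the list of the colors of its vertices and the list of their
neighborhoods, in which numbers from `I.n` on are ignored. -/
def IsDescribedBy (I : Instance k) (cs : List (Fin k × Fin k)) (xs : List (Set (Fin N))) : Prop :=
  cs = List.ofFn I.colors ∧
    ∀ v w : Fin I.n, I.graph.Adj v w ↔ ∃ x, xs[(v : ℕ)]? = some x ∧ ∃ j ∈ x, (j : ℕ) = w

theorem IsDescribedBy.unique {I J : Instance k} {cs : List (Fin k × Fin k)}
    {xs : List (Set (Fin N))} (hI : I.IsDescribedBy cs xs) (hJ : J.IsDescribedBy cs xs) :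
    I = J := by
  obtain ⟨n, G, fs, ft⟩ := I
  obtain ⟨m, H, gs, gt⟩ := J
  obtain ⟨rfl, hG⟩ := hI
  obtain ⟨hcs, hH⟩ := hJ
  obtain rfl : n = m := by simpa using congrArg List.length hcs
  obtain rfl : G = H := by
    ext v w
    exact (hG v w).trans (hH v w).symm
  have colors_eq := List.ofFn_inj.1 hcs
  obtain rfl : fs = gs := RelHom.ext fun v => congrArg Prod.fst (congrFun colors_eq v)
  obtain rfl : ft = gt := RelHom.ext fun v => congrArg Prod.snd (congrFun colors_eq v)
  rfl

end Instance

open scoped Classical in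
/-- The scanner for `k`-CRCS. It marks the vertices selected by `thin` for the profile, and keeps
their colors as its memory. The cell of a vertex `w` holds the numbers of the marked vertices
adjacent to `w`; it also records the adjacency to the current vertex, under the number this vertex
gets if it is marked. The evidence consists of the numbers of the marked vertices whose adjacencies
agree with those of the current vertex so far. -/
noncomputable def crcsScanner (k N : ℕ) :
    MatrixScanner (Fin k × Fin k) Bool (Set (Fin N)) (BoundedList (Fin k × Fin k) N)
      (Set (Fin N)) (BoundedList (Set (Fin N)) N) where
  blank := ∅
  init := .ofList N []
  start := .univ
  read e x b := {j ∈ e | j ∈ x ↔ b}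
  write m x b := {j | if (j : ℕ) = m.1.length then b else j ∈ x}
  mark m c e := decide (m.1.length < N ∧ ¬{j ∈ e | m.1[(j : ℕ)]? = some c}.Nontrivial)
  extend m c := .ofList N (m.1 ++ [c])
  empty := .ofList N []
  collect x t := .ofList N (x :: t.1)
  answer m t := decide (m.1.length < N ∧
    ∃ J : Instance k, J.IsDescribedBy m.1 t.1 ∧ J.Positive)

variable {I : Instance k}

theorem evidence_crcsScanner (cell : Fin I.n → Set (Fin N)) (v : Fin I.n) (e : Set (Fin N))
    (ws : List (Fin I.n)) :
    (crcsScanner k N).evidence I.toMatrix cell v e ws =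
      {j ∈ e | ∀ w ∈ ws, j ∈ cell w ↔ I.graph.Adj v w} := by
  induction ws generalizing e with
  | nil =>
    change e = _
    simp only [List.not_mem_nil, false_implies, implies_true, and_true, Set.ofPred_mem_eq]
  | cons w ws ih =>
    refine (ih _).trans ?_
    ext j
    simp [crcsScanner, and_assoc]

open scoped Classical in
/-- The state of a scan describes the vertices selected so far. -/
structure IsFaithful (I : Instance k) (vs : List (Fin I.n))
    (s : MatrixScanner.State (Set (Fin N)) (BoundedList (Fin k × Fin k) N) I.n) : Prop where
  marked : s.marked = thin (profile I.fs I.ft) N vs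
  memory : s.memory.1 = s.marked.map I.colors
  cell : ∀ (j : Fin N) u, s.marked[(j : ℕ)]? = some u → ∀ w, j ∈ s.cell w ↔ I.graph.Adj u w

namespace IsFaithful

variable {vs : List (Fin I.n)}
  {s : MatrixScanner.State (Set (Fin N)) (BoundedList (Fin k × Fin k) N) I.n}

theorem length_memory (h : IsFaithful I vs s) : s.memory.1.length = s.marked.length := by
  rw [h.memory, List.length_map]

theorem marksRow_iff (h : IsFaithful I vs s) (v : Fin I.n) :
    (crcsScanner k N).marksRow I.toMatrix s v = true ↔ s.marked.length < N ∧
      ¬(s.marked.map (profile I.fs I.ft)).Duplicate (profile I.fs I.ft v) := by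
  have length_le : (s.marked.map (profile I.fs I.ft)).length ≤ N := by
    rw [List.length_map, ← h.length_memory]
    exact s.memory.2
  have twins_eq : {j : Fin N | (∀ w, j ∈ s.cell w ↔ I.graph.Adj v w) ∧
        s.memory.1[(j : ℕ)]? = some (I.colors v)} =
      {j : Fin N | (s.marked.map (profile I.fs I.ft))[(j : ℕ)]? = some (profile I.fs I.ft v)} := by
    ext j
    rw [h.memory]
    cases hj : s.marked[(j : ℕ)]? with
    | none => simp [hj]
    | some u =>
      simp [hj, h.cell j u hj, profile, Instance.colors, Set.ext_iff, and_comm]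
  rw [MatrixScanner.marksRow, evidence_crcsScanner, duplicate_iff_nontrivial length_le,
    ← twins_eq, ← h.length_memory]
  simp [crcsScanner]

theorem mem_cell_scanRow (h : IsFaithful I vs s) (v w : Fin I.n) (j : Fin N) :
    j ∈ ((crcsScanner k N).scanRow I.toMatrix s v).cell w ↔
      if (j : ℕ) = s.marked.length then I.graph.Adj v w else j ∈ s.cell w := by
  rw [← h.length_memory]
  simp [MatrixScanner.scanRow, crcsScanner]

theorem scanRow (h : IsFaithful I vs s) (v : Fin I.n) :
    IsFaithful I (vs ++ [v]) ((crcsScanner k N).scanRow I.toMatrix s v) := by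
  have marked_eq := (crcsScanner k N).marked_scanRow I.toMatrix s v
  have memory_eq : ((crcsScanner k N).scanRow I.toMatrix s v).memory =
      if (crcsScanner k N).marksRow I.toMatrix s v then .ofList N (s.memory.1 ++ [I.colors v])
      else s.memory := rfl
  by_cases hmark : (crcsScanner k N).marksRow I.toMatrix s v
  · rw [if_pos hmark] at marked_eq memory_eq
    rw [h.marksRow_iff v] at hmark
    refine ⟨?_, ?_, fun j u hu w => ?_⟩
    · rw [marked_eq, thin_concat, thinStep, ← h.marked, if_pos hmark]
    · rw [memory_eq, marked_eq, List.map_append, ← h.memory]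
      refine List.take_of_length_le ?_
      rw [List.length_append, h.length_memory]
      exact hmark.1
    · rw [h.mem_cell_scanRow]
      rw [marked_eq] at hu
      split_ifs with hj
      · obtain rfl : v = u := by simpa [hj] using hu
        rfl
      · refine h.cell j u ?_ w
        rwa [List.getElem?_append_left] at hu
        have := (List.getElem?_eq_some_iff.1 hu).1
        rw [List.length_append, List.length_singleton] at this
        lia
  · rw [if_neg hmark] at marked_eq memory_eq
    rw [h.marksRow_iff v] at hmark
    refine ⟨?_, ?_, fun j u hu w => ?_⟩
    · rw [marked_eq, thin_concat, thinStep, ← h.marked, if_neg hmark]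
    · rw [memory_eq, marked_eq, h.memory]
    · rw [marked_eq] at hu
      rw [h.mem_cell_scanRow, if_neg (List.getElem?_eq_some_iff.1 hu).1.ne, h.cell j u hu w]

theorem scan (vs : List (Fin I.n)) :
    IsFaithful I vs ((crcsScanner k N).scan I.toMatrix vs) := by
  induction vs using List.reverseRecOn with
  | nil => exact ⟨rfl, List.take_nil, fun j u hu => nomatch hu⟩
  | append_singleton vs v ih =>
    exact (crcsScanner k N).scan_concat I.toMatrix vs v ▸ ih.scanRow v

end IsFaithful

/-- One more than the number of vertices a kernel of a split graph can have: two for each value of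
the key in `IsSplit.exists_profile_factorsThrough`. -/
noncomputable def kernelBound (k : ℕ) : ℕ :=
  2 * Nat.card ((Fin k × Fin k) × Prop × Set (Fin k)) + 1

namespace Instance

theorem restrict_isDescribedBy (I : Instance k) (us : List (Fin I.n)) (hN : us.length ≤ N)
    {cell : Fin I.n → Set (Fin N)}
    (hcell : ∀ (j : Fin N) u, us[(j : ℕ)]? = some u → ∀ w, j ∈ cell w ↔ I.graph.Adj u w) :
    (I.restrict us).IsDescribedBy (us.map I.colors) (us.map cell) := by
  constructor
  · exact List.ext_getElem (by simp [restrict]) fun i _ _ => by simp [colors, restrict]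
  · intro (v : Fin us.length) (w : Fin us.length)
    change I.graph.Adj (us.get v) (us.get w) ↔ _
    have row_eq : (us.map cell)[(v : ℕ)]? = some (cell (us.get v)) := by simp
    rw [row_eq, SimpleGraph.adj_comm, ← hcell (w.castLE hN) (us.get w) (by simp)]
    refine ⟨fun h => ⟨_, rfl, _, h, rfl⟩, ?_⟩
    rintro ⟨_, ⟨rfl⟩, j, hj, hjw⟩
    rwa [← Fin.ext (a := j) (b := w.castLE hN) hjw]

open scoped Classical in
/-- The vertices selected for the kernel, in the order of the scan. -/
noncomputable def kernelVertices (I : Instance k) (N : ℕ) : List (Fin I.n) :=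
  thin (profile I.fs I.ft) N (List.finRange I.n)

theorem nodup_kernelVertices : (I.kernelVertices N).Nodup :=
  (List.nodup_finRange I.n).sublist (thin_sublist _ _ _)

/-- The inclusion of the kernel. -/
noncomputable def kernelEmbedding (I : Instance k) (N : ℕ) :
    (I.restrict (I.kernelVertices N)).graph ↪g I.graph :=
  .comap ⟨(I.kernelVertices N).get, List.nodup_iff_injective_get.1 nodup_kernelVertices⟩ I.graph

theorem retainsTwins_kernelEmbedding (hN : (I.kernelVertices N).length < N) :
    RetainsTwins (I.kernelEmbedding N) I.fs I.ft := fun v hv => by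
  have hdup := duplicate_map_thin _ _ hN (List.mem_finRange v) fun h => hv (List.get_of_mem h)
  obtain ⟨a, ha, b, hb, hab⟩ := (duplicate_iff_nontrivial (List.length_map _).le _).1 hdup
  have profile_eq {a : Fin (I.kernelVertices N).length}
      (ha : ((I.kernelVertices N).map (profile I.fs I.ft))[(a : ℕ)]? =
        some (profile I.fs I.ft v)) :
      profile I.fs I.ft (I.kernelEmbedding N a) = profile I.fs I.ft v := by
    rw [List.getElem?_map, List.getElem?_eq_getElem a.isLt] at ha
    exact Option.some.inj ha
  exact ⟨a, b, hab, profile_eq ha, profile_eq hb⟩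

theorem positive_restrict_kernelVertices_iff (hN : (I.kernelVertices N).length < N) :
    (I.restrict (I.kernelVertices N)).Positive ↔ I.Positive :=
  have retains := retainsTwins_kernelEmbedding hN
  (and_congr retains.isSplit_iff retains.reconfigurable_iff).symm

theorem length_kernelVertices_lt (hI : IsSplit I.graph) :
    (I.kernelVertices (kernelBound k)).length < kernelBound k := by
  obtain ⟨key, hkey⟩ := hI.exists_profile_factorsThrough I.fs I.ft
  exact Nat.lt_succ_of_le (length_thin_le_two_mul_card _ _ hkey _)

end Instance

theorem outcome_crcsScanner_iff :
    (crcsScanner k N).outcome I.toMatrix = true ↔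
      (I.kernelVertices N).length < N ∧ (I.restrict (I.kernelVertices N)).Positive := by
  have faithful := IsFaithful.scan (I := I) (N := N) (List.finRange I.n)
  set s := (crcsScanner k N).scan I.toMatrix (List.finRange I.n)
  have marked_eq : s.marked = I.kernelVertices N := faithful.marked
  have length_le : s.marked.length ≤ N := marked_eq ▸ length_thin_le _ _ _
  have collected : ((s.marked.map s.cell).foldr (crcsScanner k N).collect
      (crcsScanner k N).empty).1 = s.marked.map s.cell := by
    refine (congrArg Subtype.val (BoundedList.foldr_ofList_cons N _)).trans ?_
    exact List.take_of_length_le (by rwa [List.length_map])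
  have described : (I.restrict s.marked).IsDescribedBy (s.marked.map I.colors)
      (s.marked.map s.cell) := I.restrict_isDescribedBy _ length_le faithful.cell
  classical
  refine decide_eq_true_iff.trans ?_
  rw [collected, faithful.memory, List.length_map, ← marked_eq]
  exact and_congr_right fun _ =>
    ⟨fun ⟨J, hJ, hpos⟩ => hJ.unique described ▸ hpos, fun hpos => ⟨_, described, hpos⟩⟩

theorem outcome_crcsScanner_kernelBound_iff (I : Instance k) :
    (crcsScanner k (kernelBound k)).outcome I.toMatrix = true ↔ I.Positive := by
  rw [outcome_crcsScanner_iff]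
  exact ⟨fun ⟨hlen, hpos⟩ => (Instance.positive_restrict_kernelVertices_iff hlen).1 hpos,
    fun hpos =>
      have hlen := Instance.length_kernelVertices_lt hpos.1
      ⟨hlen, (Instance.positive_restrict_kernelVertices_iff hlen).2 hpos⟩⟩

end Scanner

end ColorSwap

theorem mainTheorem9 (k : ℕ) (hk : 0 < k) :
    ColorSwap.SolvableInPolyTime (ColorSwap.Instance.encode (k := k))
      (fun I => ColorSwap.IsSplit I.graph ∧ ColorSwap.Reconfigurable I.fs I.ft) := by
  exact (ColorSwap.crcsScanner k (ColorSwap.kernelBound k)).solvableInPolyTime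
    ColorSwap.Instance.toMatrix ColorSwap.outcome_crcsScanner_kernelBound_iff
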